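/- A bivariate copula density is a density, with respect to Lebesgue measure, of a probability measure on $\mathbb{R}^2$ whose two marginals are both uniform on $(0,1)$. Let $f_0$ be a probability density on $\mathbb{R}$ with $f_0>0$, let $(c_n)_{n\ge 0}$ be bivariate copula densities with $c_n>0$ on $(0,1)^2$, and let $r_n\in(0,1]$ for $n\ge 0$. Define recursively, for $n\ge 0$, $y\in\mathbb{R}^n$ and $x,z\in\mathbb{R}$, $$f_{n+1}(x\mid y,z)=(1-r_n)\,f_n(x\mid y)+r_n\,f_n(x\mid y)\,c_n\bigl(F_n(x\mid y),F_n(z\mid y)\bigr),\qquad F_n(x\mid y)=\int_{-\infty}^x f_n(t\mid y)\,dt,$$ where $f_0(x\mid y)=f_0(x)$ for $n=0$. Let $X=(X_1,X_2,\dots)$ be a sequence of real random variables on a probability space $(\Omega,\mathcal{A},P)$ whose predictive distributions are $\beta_n(dx)=f_n(x\mid X_1,\dots,X_n)\,dx$, that is, $P(X_{n+1}\in A\mid X_1,\dots,X_n)=\int_A f_n(x\mid X_1,\dots,X_n)\,dx$ a.s. for all $n\ge 0$ and all Borel sets $A\subset\mathbb{R}$. Assume that $$\int_{-\infty}^\infty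 f_0(x)^2\,dx<\infty,\qquad \sum_n r_n^2<\infty,$$ and that there is a constant $b$ with $c_n(u,v)\le b$ for all $n\ge 0$ and $u,v\in[0,1]$. Then there is a random probability measure $\beta$ on $\mathbb{R}$ such that $\beta_n\to\beta$ weakly a.s., this limit has a random density, i.e. there is a jointly measurable $f:\Omega\times\mathbb{R}\to[0,\infty)$ such that $f(\omega,\cdot)$ is a probability density for every $\omega$ and $\beta(\omega,dx)=f(\omega,x)\,dx$ for $P$-almost all $\omega$, and $\beta_n\to\beta$ in total variation a.s., i.e. $\sup_{A}|\beta_n(A)-\beta(A)|\to 0$ a.s., the supremum being over Borel sets $A\subset\mathbb{R}$. -/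

import Mathlib

open MeasureTheory ProbabilityTheory Filter Topology Set
open scoped ENNReal BoundedContinuousFunction

noncomputable section

namespace CopulaPredictive

/-- `f` is a probability density on `ℝ` with respect to Lebesgue measure. -/
structure IsDensity (f : ℝ → ℝ) : Prop where
  measurable : Measurable f
  nonneg : ∀ x, 0 ≤ f x
  lintegral_eq_one : ∫⁻ x, ENNReal.ofReal (f x) = 1

/-- The measure `f(x) dx` on `ℝ`. -/
def densityMeasure (f : ℝ → ℝ) : Measure ℝ :=
  volume.withDensity fun x => ENNReal.ofReal (f x)

/-- A bivariate copula, seen as a Borel measure on the plane: both of its marginals are uniform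
on `(0,1)` (in particular it is a probability measure). -/
structure IsCopula (C : Measure (ℝ × ℝ)) : Prop where
  map_fst : C.map Prod.fst = volume.restrict (Ioo 0 1)
  map_snd : C.map Prod.snd = volume.restrict (Ioo 0 1)

/-- `c` is a bivariate copula density: a Borel version of the Lebesgue density of a copula. -/
structure IsCopulaDensity (c : ℝ → ℝ → ℝ) : Prop where
  measurable : Measurable (Function.uncurry c)
  nonneg : ∀ u v, 0 ≤ c u v
  isCopula : IsCopula
    ((volume : Measure (ℝ × ℝ)).withDensity fun p => ENNReal.ofReal (c p.1 p.2))

/-- The distribution function `x ↦ ∫_{-∞}^x f(t) dt` corresponding to the density `f`. -/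
def distFun (f : ℝ → ℝ) (x : ℝ) : ℝ := ∫ t in Iic x, f t

/-- The predictive densities: `predDensity f₀ c r n y x` is `f_n(x | y)` with `y ∈ ℝⁿ`. It is given
by `f_0(x) = f₀(x)` and, for `y ∈ ℝⁿ` and `z ∈ ℝ`,
`f_{n+1}(x | y, z) = (1 - r_n) f_n(x | y) + r_n f_n(x | y) c_n(F_n(x | y), F_n(z | y))`,
where `F_n(· | y)` is the distribution function corresponding to `f_n(· | y)`. -/
def predDensity (f₀ : ℝ → ℝ) (c : ℕ → ℝ → ℝ → ℝ) (r : ℕ → ℝ) : (n : ℕ) → (Fin n → ℝ) → ℝ → ℝ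
  | 0, _, x => f₀ x
  | n + 1, yz, x =>
      let f : ℝ → ℝ := predDensity f₀ c r n (Fin.init yz)
      let z : ℝ := yz (Fin.last n)
      (1 - r n) * f x + r n * f x * c n (distFun f x) (distFun f z)

variable {Ω : Type*}

/-- The data `X(n) = (X_1, …, X_n)`; here `X i` stands for `X_{i+1}`. -/
def firstObs (X : ℕ → Ω → ℝ) (n : ℕ) (ω : Ω) : Fin n → ℝ := fun i => X i ω

/-- The copula-based predictive distribution `β_n(dx) = f_n(x | X(n)) dx`. -/
def copulaPredictive (f₀ : ℝ → ℝ) (c : ℕ → ℝ → ℝ → ℝ) (r : ℕ → ℝ) (X : ℕ → Ω → ℝ)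
    (n : ℕ) (ω : Ω) : Measure ℝ :=
  densityMeasure (predDensity f₀ c r n (firstObs X n ω))

/-- The random measures `α_n` are the predictive distributions of `X` under `P`: for every Borel
set `A`, `α_n(A) = P(X_{n+1} ∈ A | X_1, …, X_n)` almost surely (for `n = 0` this is
the law of `X_1`, as `σ(X(0))` is trivial). -/
def HasPredictives [MeasurableSpace Ω] (P : Measure Ω) (X : ℕ → Ω → ℝ)
    (α : ℕ → Ω → Measure ℝ) : Prop :=
  ∀ (n : ℕ) (A : Set ℝ), MeasurableSet A →
    (fun ω => (α n ω).real A) =ᵐ[P]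
      P⟦X n ⁻¹' A | MeasurableSpace.comap (firstObs X n) MeasurableSpace.pi⟧

/-- Weak convergence of a sequence of measures on `ℝ`. -/
def WeaklyTendsto (μ : ℕ → Measure ℝ) (ν : Measure ℝ) : Prop :=
  ∀ g : ℝ →ᵇ ℝ, Tendsto (fun n => ∫ x, g x ∂(μ n)) atTop (𝓝 (∫ x, g x ∂ν))

/-- Total variation distance `sup_A |μ(A) - ν(A)|`, over Borel sets, of two probability measures. -/
def tvDist (μ ν : Measure ℝ) : ℝ :=
  ⨆ A : {A : Set ℝ // MeasurableSet A}, |μ.real A.1 - ν.real A.1|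

end CopulaPredictive

end

namespace CopulaPredictive

/-! For almost every fixed `x` the values `f_n(x | X(n))` form a nonnegative martingale. Given
`X(n)`, the next observation `z` has density `f_n`, so `F_n(z)` is uniform on `(0,1)`, and since a
copula has a uniform marginal, `c_n(F_n(x), F_n(z))` averages to `1` over `z`. The martingale
therefore converges a.s.

The danger is loss of mass in the limit. Because `c_n ≤ b`, averaging the squared update multiplies
`f_n(x)^2` by at most `1 + b r_n^2`, so the second moments stay below `exp(b ∑ r_k^2) f₀(x)^2`. This
gives uniform integrability, and the limit still has mean at least `f₀(x)`
(`ae_le_lintegral_liminf_predDensity`). Integrating over `x`, the limit has expected total mass at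
least `1`; Fatou bounds the total mass by `1` almost surely, so it equals `1` a.s.
(`exists_ae_tendsto_predDensity`). Scheffé's lemma then turns a.e. convergence of densities into
convergence in `L¹`, hence in total variation and weakly. -/

/-! ### Densities, distribution functions and the probability integral transform -/

lemma IsDensity.integrable {f : ℝ → ℝ} (hf : IsDensity f) : Integrable f := by
  refine ⟨hf.measurable.aestronglyMeasurable, ?_⟩
  rw [hasFiniteIntegral_iff_ofReal (ae_of_all _ hf.nonneg), hf.lintegral_eq_one]
  exact ENNReal.one_lt_top

lemma IsDensity.isProbabilityMeasure {f : ℝ → ℝ} (hf : IsDensity f) :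
    IsProbabilityMeasure (densityMeasure f) :=
  ⟨by rw [densityMeasure, withDensity_apply _ MeasurableSet.univ, Measure.restrict_univ,
    hf.lintegral_eq_one]⟩

lemma IsDensity.distFun_eq_cdf {f : ℝ → ℝ} (hf : IsDensity f) (x : ℝ) :
    distFun f x = cdf (densityMeasure f) x := by
  have := hf.isProbabilityMeasure
  rw [cdf_eq_real, measureReal_def, densityMeasure, withDensity_apply _ measurableSet_Iic, distFun,
    integral_eq_lintegral_of_nonneg_ae (ae_of_all _ hf.nonneg)
      hf.measurable.aestronglyMeasurable]

lemma IsDensity.distFun_mem_Icc {f : ℝ → ℝ} (hf : IsDensity f) (x : ℝ) :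
    distFun f x ∈ Icc (0 : ℝ) 1 := by
  rw [hf.distFun_eq_cdf]
  exact ⟨cdf_nonneg _ _, cdf_le_one _ _⟩

lemma IsDensity.monotone_distFun {f : ℝ → ℝ} (hf : IsDensity f) : Monotone (distFun f) := by
  intro x y hxy
  simp_rw [hf.distFun_eq_cdf]
  exact monotone_cdf _ hxy

lemma IsDensity.continuous_distFun {f : ℝ → ℝ} (hf : IsDensity f) : Continuous (distFun f) := by
  have h : ∀ x, distFun f x = (∫ t in Iic 0, f t) + ∫ t in (0 : ℝ)..x, f t := fun x ↦ by
    rw [← intervalIntegral.integral_Iic_sub_Iic hf.integrable.integrableOn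
      hf.integrable.integrableOn]
    simp [distFun]
  rw [show distFun f = fun x ↦ _ from funext h]
  exact continuous_const.add
    (intervalIntegral.continuous_primitive (fun a b ↦ hf.integrable.intervalIntegrable) 0)

lemma IsDensity.exists_distFun_eq {f : ℝ → ℝ} (hf : IsDensity f) {u : ℝ} (hu : u ∈ Ioo (0 : ℝ) 1) :
    ∃ x, distFun f x = u := by
  have h0 : Tendsto (distFun f) atBot (𝓝 0) := by
    rw [show distFun f = _ from funext hf.distFun_eq_cdf]
    exact tendsto_cdf_atBot _
  have h1 : Tendsto (distFun f) atTop (𝓝 1) := by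
    rw [show distFun f = _ from funext hf.distFun_eq_cdf]
    exact tendsto_cdf_atTop _
  obtain ⟨a, ha⟩ := (h0.eventually (gt_mem_nhds hu.1)).exists
  obtain ⟨d, hd⟩ := (h1.eventually (lt_mem_nhds hu.2)).exists
  exact mem_range_of_exists_le_of_exists_ge hf.continuous_distFun ⟨a, ha.le⟩ ⟨d, hd.le⟩

lemma IsDensity.measure_Iic {f : ℝ → ℝ} (hf : IsDensity f) (x : ℝ) :
    densityMeasure f (Iic x) = ENNReal.ofReal (distFun f x) := by
  have := hf.isProbabilityMeasure
  rw [hf.distFun_eq_cdf, ofReal_cdf]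

/-- The probability integral transform. -/
lemma IsDensity.map_distFun {f : ℝ → ℝ} (hf : IsDensity f) :
    (densityMeasure f).map (distFun f) = volume.restrict (Ioo 0 1) := by
  have := hf.isProbabilityMeasure
  refine Measure.ext_of_Iic _ _ fun u ↦ ?_
  rw [Measure.map_apply hf.continuous_distFun.measurable measurableSet_Iic,
    Measure.restrict_apply measurableSet_Iic]
  -- `F` need not be injective, so no inverse is used: for `v = F x > u`, the set `{F ≤ u}` lies in
  -- `Iic x`, which has mass `v`. Then `v` decreases to `u`.
  have hmid : ∀ u ∈ Ico (0 : ℝ) 1, densityMeasure f (distFun f ⁻¹' Iic u) ≤ ENNReal.ofReal u := by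
    intro u hu
    have hle : ∀ v ∈ Ioo u 1, densityMeasure f (distFun f ⁻¹' Iic u) ≤ ENNReal.ofReal v := by
      intro v hv
      obtain ⟨x, hx⟩ := hf.exists_distFun_eq (u := v) ⟨hu.1.trans_lt hv.1, hv.2⟩
      rw [← hx, ← hf.measure_Iic]
      refine measure_mono fun t ht ↦ ?_
      by_contra hlt
      have h1 := hf.monotone_distFun (not_le.1 hlt).le
      have h2 : distFun f t ≤ u := ht
      linarith [hv.1]
    have htend : Tendsto (fun v ↦ ENNReal.ofReal v) (𝓝[>] u) (𝓝 (ENNReal.ofReal u)) :=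
      (ENNReal.continuous_ofReal.tendsto u).mono_left nhdsWithin_le_nhds
    exact ge_of_tendsto htend (by filter_upwards [Ioo_mem_nhdsGT hu.2] with v hv using hle v hv)
  rcases lt_or_ge u 0 with h0 | h0
  · have e1 : distFun f ⁻¹' Iic u = ∅ := by
      ext t
      have := (hf.distFun_mem_Icc t).1
      simp only [mem_preimage, mem_Iic, mem_empty_iff_false, iff_false, not_le]
      linarith
    have e2 : Iic u ∩ Ioo (0 : ℝ) 1 = ∅ := by
      ext t
      simp only [mem_inter_iff, mem_Iic, mem_Ioo, mem_empty_iff_false, iff_false]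
      rintro ⟨h, h', -⟩
      linarith
    simp [e1, e2]
  rcases lt_or_ge u 1 with h1 | h1
  · have e2 : volume (Iic u ∩ Ioo (0 : ℝ) 1) = ENNReal.ofReal u := by
      have : Iic u ∩ Ioo (0 : ℝ) 1 = Ioc 0 u := by
        ext t
        simp only [mem_inter_iff, mem_Iic, mem_Ioo, mem_Ioc]
        exact ⟨fun h ↦ ⟨h.2.1, h.1⟩, fun h ↦ ⟨h.2, h.1, h.2.trans_lt h1⟩⟩
      rw [this, Real.volume_Ioc, sub_zero]
    rw [e2]
    refine le_antisymm (hmid u ⟨h0, h1⟩) ?_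
    rcases h0.eq_or_lt with rfl | h0'
    · simp
    obtain ⟨x, hx⟩ := hf.exists_distFun_eq (u := u) ⟨h0', h1⟩
    rw [← hx, ← hf.measure_Iic]
    exact measure_mono fun t ht ↦ hf.monotone_distFun ht
  · have e1 : distFun f ⁻¹' Iic u = univ := by
      ext t
      simpa using (hf.distFun_mem_Icc t).2.trans h1
    have e2 : Iic u ∩ Ioo (0 : ℝ) 1 = Ioo 0 1 :=
      inter_eq_right.2 fun t ht ↦ ht.2.le.trans h1
    simp [e1, e2]

lemma IsDensity.lintegral_comp_distFun {f : ℝ → ℝ} (hf : IsDensity f) {g : ℝ → ℝ≥0∞}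
    (hg : Measurable g) :
    ∫⁻ x, ENNReal.ofReal (f x) * g (distFun f x) = ∫⁻ u in Ioo 0 1, g u := by
  rw [← hf.map_distFun, lintegral_map hg hf.continuous_distFun.measurable, densityMeasure,
    lintegral_withDensity_eq_lintegral_mul (g := fun x ↦ g (distFun f x)) _
      hf.measurable.ennreal_ofReal (hg.comp hf.continuous_distFun.measurable)]
  rfl

/-! ### Averaging a copula density over one argument -/

lemma IsCopulaDensity.ae_lintegral_eq_one {c : ℝ → ℝ → ℝ} (hc : IsCopulaDensity c) :
    ∀ᵐ u ∂(volume.restrict (Ioo (0 : ℝ) 1)), ∫⁻ v in Ioo 0 1, ENNReal.ofReal (c u v) = 1 := by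
  have hm : Measurable fun p : ℝ × ℝ ↦ ENNReal.ofReal (c p.1 p.2) := hc.measurable.ennreal_ofReal
  set C : Measure (ℝ × ℝ) := volume.withDensity fun p ↦ ENNReal.ofReal (c p.1 p.2) with hC
  -- The second marginal confines the mass to the strip `ℝ × (0,1)`; the first marginal can then be
  -- computed by integrating `v` over `(0,1)` only.
  have hout : C (univ ×ˢ (Ioo (0 : ℝ) 1)ᶜ) = 0 := by
    have := Measure.map_apply (μ := C) measurable_snd (measurableSet_Ioo (a := (0 : ℝ)) (b := 1)).compl
    rw [hc.isCopula.map_snd, Measure.restrict_apply measurableSet_Ioo.compl, compl_inter_self,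
      measure_empty] at this
    rw [univ_prod, ← this]
  refine ae_eq_of_forall_setLIntegral_eq_of_sigmaFinite (hm.lintegral_prod_right') measurable_const
    fun A hA _ ↦ ?_
  have h1 : ∀ A : Set ℝ, MeasurableSet A →
      ∫⁻ u in A, ∫⁻ v in Ioo 0 1, ENNReal.ofReal (c u v) = volume (A ∩ Ioo 0 1) := by
    intro A hA
    have := Measure.map_apply (μ := C) measurable_fst hA
    rw [hc.isCopula.map_fst, Measure.restrict_apply hA] at this
    rw [this, ← measure_inter_add_sdiff₀ (μ := C) (Prod.fst ⁻¹' A)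
      (t := univ ×ˢ Ioo (0 : ℝ) 1) (MeasurableSet.univ.prod measurableSet_Ioo).nullMeasurableSet,
      measure_mono_null (s := _ \ _) (t := univ ×ˢ (Ioo (0 : ℝ) 1)ᶜ) _ hout, add_zero]
    · have : Prod.fst ⁻¹' A ∩ univ ×ˢ Ioo (0 : ℝ) 1 = A ×ˢ Ioo (0 : ℝ) 1 := by
        ext p; simp
      rw [this, hC, withDensity_apply _ (hA.prod measurableSet_Ioo), Measure.volume_eq_prod,
        ← Measure.prod_restrict, lintegral_prod _ hm.aemeasurable]
    · rintro p ⟨_, hp⟩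
      simpa using hp
  rw [Measure.restrict_restrict hA, h1 _ (hA.inter measurableSet_Ioo), inter_assoc, inter_self]
  simp

/-- The transform makes `F(z)` uniform, so `c` integrates to `1`. The exceptional null set precedes
`a` and `d`, which may thus depend on `x`; this serves both first and second moments. The
alternative `f x = 0` appears because the copula identity is pulled back only to almost every point
for `f(x) dx`. -/
lemma IsDensity.ae_lintegral_affine_copula {f : ℝ → ℝ} (hf : IsDensity f) {c : ℝ → ℝ → ℝ}
    (hc : IsCopulaDensity c) :
    ∀ᵐ x, f x = 0 ∨ ∀ a d : ℝ, 0 ≤ a → 0 ≤ d →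
      ∫⁻ z, ENNReal.ofReal (f z) * ENNReal.ofReal (a + d * c (distFun f x) (distFun f z)) =
        ENNReal.ofReal (a + d) := by
  have h : ∀ᵐ u ∂((densityMeasure f).map (distFun f)),
      ∫⁻ v in Ioo 0 1, ENNReal.ofReal (c u v) = 1 := by
    rw [hf.map_distFun]
    exact hc.ae_lintegral_eq_one
  replace h := ae_of_ae_map hf.continuous_distFun.measurable.aemeasurable h
  rw [densityMeasure, ae_withDensity_iff hf.measurable.ennreal_ofReal] at h
  filter_upwards [h] with x hx
  rcases (hf.nonneg x).eq_or_lt with h0 | h0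
  · exact Or.inl h0.symm
  right
  intro a d ha hd
  have hx := hx (by simpa using h0)
  have hm : Measurable fun v ↦ c (distFun f x) v :=
    hc.measurable.comp (measurable_const.prodMk measurable_id)
  rw [hf.lintegral_comp_distFun (g := fun v ↦ ENNReal.ofReal (a + d * c (distFun f x) v))
    (by fun_prop)]
  simp_rw [ENNReal.ofReal_add ha (mul_nonneg hd (hc.nonneg _ _)), ENNReal.ofReal_mul hd]
  rw [lintegral_add_left measurable_const, lintegral_const_mul _ hm.ennreal_ofReal, hx,
    ENNReal.ofReal_add ha hd]
  simp

/-- The update of the density `f` after observing `z`. -/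
noncomputable def copulaStep (f : ℝ → ℝ) (c : ℝ → ℝ → ℝ) (r z x : ℝ) : ℝ :=
  (1 - r) * f x + r * f x * c (distFun f x) (distFun f z)

lemma IsDensity.ae_lintegral_copulaStep {f : ℝ → ℝ} (hf : IsDensity f) {c : ℝ → ℝ → ℝ}
    (hc : IsCopulaDensity c) {r : ℝ} (hr : r ∈ Ioc (0 : ℝ) 1) :
    ∀ᵐ x, ∫⁻ z, ENNReal.ofReal (f z) * ENNReal.ofReal (copulaStep f c r z x) =
      ENNReal.ofReal (f x) := by
  filter_upwards [hf.ae_lintegral_affine_copula hc] with x hx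
  rcases hx with h0 | hx
  · simp [copulaStep, h0]
  have := hx ((1 - r) * f x) (r * f x) (mul_nonneg (by linarith [hr.2]) (hf.nonneg x))
    (mul_nonneg hr.1.le (hf.nonneg x))
  rw [show (1 - r) * f x + r * f x = f x by ring] at this
  exact this

lemma IsDensity.ae_lintegral_copulaStep_sq_le {f : ℝ → ℝ} (hf : IsDensity f) {c : ℝ → ℝ → ℝ}
    (hc : IsCopulaDensity c) {r : ℝ} (hr : r ∈ Ioc (0 : ℝ) 1) {b : ℝ}
    (hb : ∀ u ∈ Icc (0 : ℝ) 1, ∀ v ∈ Icc (0 : ℝ) 1, c u v ≤ b) :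
    ∀ᵐ x, ∫⁻ z, ENNReal.ofReal (f z) * ENNReal.ofReal (copulaStep f c r z x ^ 2) ≤
      ENNReal.ofReal (1 + b * r ^ 2) * ENNReal.ofReal (f x ^ 2) := by
  have hb0 : 0 ≤ b := (hc.nonneg 0 0).trans (hb 0 (by simp) 0 (by simp))
  filter_upwards [hf.ae_lintegral_affine_copula hc] with x hx
  rcases hx with h0 | hx
  · simp [copulaStep, h0]
  have hr1 : 0 ≤ 1 - r := by linarith [hr.2]
  have hr0 := hr.1.le
  -- Expanding `((1 - r) + r * y) ^ 2` and using `y ^ 2 ≤ b * y` gives a bound affine in `y`. Its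
  -- average is `1 - r ^ 2 + b * r ^ 2` times `f x ^ 2`: the terms linear in `r` cancel, so
  -- summability of `r n ^ 2` suffices.
  have := hx ((1 - r) ^ 2 * f x ^ 2) ((2 * (1 - r) * r + r ^ 2 * b) * f x ^ 2)
    (by positivity) (by positivity)
  calc _ ≤ _ := lintegral_mono fun z ↦ ?_
    _ = _ := this
    _ ≤ _ := ?_
  · gcongr
    have h1 := hb _ (hf.distFun_mem_Icc x) _ (hf.distFun_mem_Icc z)
    have h2 := hc.nonneg (distFun f x) (distFun f z)
    set y := c (distFun f x) (distFun f z)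
    have h3 : y * y ≤ b * y := mul_le_mul_of_nonneg_right h1 h2
    have h4 : 0 ≤ r ^ 2 * f x ^ 2 := by positivity
    have h5 := mul_le_mul_of_nonneg_left h3 h4
    simp only [copulaStep]
    change ((1 - r) * f x + r * f x * y) ^ 2 ≤ _
    nlinarith
  · rw [← ENNReal.ofReal_mul (by positivity)]
    apply ENNReal.ofReal_le_ofReal
    have : 0 ≤ r ^ 2 * f x ^ 2 := by positivity
    nlinarith

/-! ### Positivity and joint measurability of the recursion -/

lemma predDensity_succ_eq_copulaStep (f₀ : ℝ → ℝ) (c : ℕ → ℝ → ℝ → ℝ) (r : ℕ → ℝ) (n : ℕ)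
    (y : Fin (n + 1) → ℝ) (x : ℝ) :
    predDensity f₀ c r (n + 1) y x =
      copulaStep (predDensity f₀ c r n (Fin.init y)) (c n) (r n) (y (Fin.last n)) x := rfl

lemma predDensity_nonneg {f₀ : ℝ → ℝ} (hf₀ : IsDensity f₀) {c : ℕ → ℝ → ℝ → ℝ}
    (hc : ∀ n, IsCopulaDensity (c n)) {r : ℕ → ℝ} (hr : ∀ n, r n ∈ Ioc (0 : ℝ) 1) (n : ℕ)
    (y : Fin n → ℝ) (x : ℝ) : 0 ≤ predDensity f₀ c r n y x := by
  induction n generalizing x with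
  | zero => exact hf₀.nonneg x
  | succ n ih =>
    rw [predDensity_succ_eq_copulaStep, copulaStep]
    have h1 : 0 ≤ 1 - r n := by linarith [(hr n).2]
    have h2 := (hr n).1.le
    have h3 := ih (Fin.init y) x
    have h4 := (hc n).nonneg (distFun (predDensity f₀ c r n (Fin.init y)) x)
      (distFun (predDensity f₀ c r n (Fin.init y)) (y (Fin.last n)))
    positivity

lemma measurable_uncurry_distFun {α : Type*} [MeasurableSpace α] {g : α → ℝ → ℝ}
    (hg : Measurable (Function.uncurry g)) :
    Measurable (Function.uncurry fun a x ↦ distFun (g a) x) := by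
  have h : (Function.uncurry fun a x ↦ distFun (g a) x) =
      fun p : α × ℝ ↦ ∫ t, {q : (α × ℝ) × ℝ | q.2 ≤ q.1.2}.indicator
        (fun q ↦ g q.1.1 q.2) (p, t) := by
    ext p
    simp only [Function.uncurry, distFun]
    rw [← integral_indicator measurableSet_Iic]
    rfl
  rw [h]
  refine (StronglyMeasurable.integral_prod_right' (f := {q : (α × ℝ) × ℝ | q.2 ≤ q.1.2}.indicator
        (fun q ↦ g q.1.1 q.2)) ?_).measurable
  refine (Measurable.indicator ?_ ?_).stronglyMeasurable
  · exact hg.comp (f := fun q : (α × ℝ) × ℝ ↦ (q.1.1, q.2)) (by fun_prop)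
  · exact measurableSet_le (by fun_prop) (by fun_prop)

lemma measurable_copulaStep {α : Type*} [MeasurableSpace α] {g : α → ℝ → ℝ}
    (hg : Measurable (Function.uncurry g)) {c : ℝ → ℝ → ℝ} (hc : IsCopulaDensity c) (r : ℝ) :
    Measurable fun q : (α × ℝ) × ℝ ↦ copulaStep (g q.1.1) c r q.1.2 q.2 := by
  have hF := measurable_uncurry_distFun hg
  have hx : Measurable fun q : (α × ℝ) × ℝ ↦ (q.1.1, q.2) := by fun_prop
  have h1 := hg.comp hx
  have h2 := hc.measurable.comp ((hF.comp hx).prodMk (hF.comp measurable_fst))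
  exact (h1.const_mul (1 - r)).add ((h1.const_mul r).mul h2)

lemma measurable_uncurry_predDensity {f₀ : ℝ → ℝ} (hf₀ : IsDensity f₀) {c : ℕ → ℝ → ℝ → ℝ}
    (hc : ∀ n, IsCopulaDensity (c n)) (r : ℕ → ℝ) (n : ℕ) :
    Measurable (Function.uncurry (predDensity f₀ c r n)) := by
  induction n with
  | zero => exact hf₀.measurable.comp measurable_snd
  | succ n ih =>
    have hinit : Measurable fun p : (Fin (n + 1) → ℝ) × ℝ ↦ (Fin.init p.1 : Fin n → ℝ) :=
      measurable_pi_lambda _ fun i ↦ (measurable_pi_apply _).comp measurable_fst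
    have hlast : Measurable fun p : (Fin (n + 1) → ℝ) × ℝ ↦ p.1 (Fin.last n) :=
      (measurable_pi_apply _).comp measurable_fst
    exact (measurable_copulaStep ih (hc n) (r n)).comp
      ((hinit.prodMk hlast).prodMk measurable_snd)

/-! ### Observations and the disintegration of their joint law -/

variable {Ω : Type*} [MeasurableSpace Ω]

lemma measurable_firstObs {X : ℕ → Ω → ℝ} (hX : ∀ n, Measurable (X n)) (n : ℕ) :
    Measurable (firstObs X n) := measurable_pi_lambda _ fun i ↦ hX i

/-- The filtration generated by the observations, with the trivial σ-algebra at time `0`. -/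
def obsFiltration {X : ℕ → Ω → ℝ} (hX : ∀ n, Measurable (X n)) :
    Filtration ℕ ‹MeasurableSpace Ω› where
  seq n := MeasurableSpace.comap (firstObs X n) MeasurableSpace.pi
  mono' n m h := by
    have : firstObs X n = (fun (y : Fin m → ℝ) (i : Fin n) ↦ y (Fin.castLE h i)) ∘ firstObs X m :=
      rfl
    change MeasurableSpace.comap (firstObs X n) _ ≤ _
    rw [this, ← MeasurableSpace.comap_comp]
    exact MeasurableSpace.comap_mono
      (measurable_pi_lambda _ fun i ↦ measurable_pi_apply _).comap_le
  le' n := (measurable_firstObs hX n).comap_le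

section

variable {P : Measure Ω} [IsProbabilityMeasure P] {X : ℕ → Ω → ℝ} (hX : ∀ n, Measurable (X n))
  {p : (n : ℕ) → (Fin n → ℝ) → ℝ → ℝ} (hp_meas : ∀ n, Measurable (Function.uncurry (p n)))
  (hp_nonneg : ∀ n y x, 0 ≤ p n y x)
  (hpred : HasPredictives P X fun n ω ↦ densityMeasure (p n (firstObs X n ω)))

include hX hp_meas hp_nonneg hpred

lemma ae_isDensity (n : ℕ) : ∀ᵐ ω ∂P, IsDensity (p n (firstObs X n ω)) := by
  have h := hpred n univ MeasurableSet.univ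
  have hle : MeasurableSpace.comap (firstObs X n) MeasurableSpace.pi ≤ ‹MeasurableSpace Ω› :=
    (measurable_firstObs hX n).comap_le
  simp only [preimage_univ, indicator_univ] at h
  rw [condExp_const hle] at h
  filter_upwards [h] with ω hω
  refine ⟨(hp_meas n).comp measurable_prodMk_left, hp_nonneg n _, ?_⟩
  -- An infinite mass would have real value `0`, so real mass `1` is genuine mass `1`.
  have h1 := (ENNReal.toReal_eq_one_iff _).1 hω
  rwa [densityMeasure, withDensity_apply _ MeasurableSet.univ, Measure.restrict_univ] at h1

/-- Disintegration of the law of `(X_1, …, X_n, X_{n+1})` along the predictive density. -/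
lemma lintegral_firstObs_obs (n : ℕ) {G : (Fin n → ℝ) × ℝ → ℝ≥0∞} (hG : Measurable G) :
    ∫⁻ ω, G (firstObs X n ω, X n ω) ∂P =
      ∫⁻ ω, (∫⁻ z, ENNReal.ofReal (p n (firstObs X n ω) z) * G (firstObs X n ω, z)) ∂P := by
  have hY := measurable_firstObs hX n
  have hd := ae_isDensity hX hp_meas hp_nonneg hpred n
  have hpm : Measurable fun q : (Fin n → ℝ) × ℝ ↦ ENNReal.ofReal (p n q.1 q.2) :=
    (hp_meas n).ennreal_ofReal
  have key : P.map (fun ω ↦ (firstObs X n ω, X n ω)) =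
      ((P.map (firstObs X n)).prod volume).withDensity
        fun q ↦ ENNReal.ofReal (p n q.1 q.2) := by
    have := Measure.isProbabilityMeasure_map (μ := P) (hY.prodMk (hX n)).aemeasurable
    -- On a rectangle `B ×ˢ A` the identity is the defining property of `P(X_{n+1} ∈ A | X(n))`,
    -- tested on the event `X(n) ∈ B`.
    refine Measure.ext_prod fun {B A} hB hA ↦ ?_
    rw [Measure.map_apply (hY.prodMk (hX n)) (hB.prod hA),
      withDensity_apply _ (hB.prod hA), ← Measure.prod_restrict,
      lintegral_prod _ hpm.aemeasurable, setLIntegral_map hB hpm.lintegral_prod_right' hY]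
    have hle : MeasurableSpace.comap (firstObs X n) MeasurableSpace.pi ≤ ‹MeasurableSpace Ω› :=
      hY.comap_le
    have hB' : MeasurableSet[MeasurableSpace.comap (firstObs X n) MeasurableSpace.pi]
      (firstObs X n ⁻¹' B) := ⟨B, hB, rfl⟩
    have h1 := setIntegral_condExp (μ := P) hle
      (f := (X n ⁻¹' A).indicator fun _ ↦ (1 : ℝ))
      ((integrable_const _).indicator (hX n hA)) hB'
    rw [setIntegral_congr_ae (hle _ hB')
      ((hpred n A hA).mono fun ω hω _ ↦ hω.symm), integral_indicator (hX n hA),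
      Measure.restrict_restrict (hX n hA), setIntegral_const, smul_eq_mul, mul_one] at h1
    have hmeas : Measurable fun ω ↦ (densityMeasure (p n (firstObs X n ω))) A := by
      simp only [densityMeasure, withDensity_apply _ hA]
      exact hpm.lintegral_prod_right'.comp hY
    rw [show (fun ω ↦ (firstObs X n ω, X n ω)) ⁻¹' B ×ˢ A = X n ⁻¹' A ∩ firstObs X n ⁻¹' B by
      ext; simp [and_comm], ← ENNReal.ofReal_toReal (measure_ne_top P _)]
    rw [measureReal_def] at h1
    rw [← h1, ofReal_integral_eq_lintegral_ofReal]
    · refine setLIntegral_congr_fun_ae (hle _ hB') ?_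
      filter_upwards [hd] with ω hω _
      have := hω.isProbabilityMeasure
      rw [ofReal_measureReal (measure_ne_top _ _), densityMeasure, withDensity_apply _ hA]
    · refine Integrable.integrableOn (Integrable.of_bound
        hmeas.ennreal_toReal.aestronglyMeasurable 1 ?_)
      filter_upwards [hd] with ω hω
      have := hω.isProbabilityMeasure
      rw [Real.norm_of_nonneg measureReal_nonneg]
      exact measureReal_le_one
    · exact ae_of_all _ fun _ ↦ measureReal_nonneg
  calc _ = ∫⁻ q, G q ∂(P.map (fun ω ↦ (firstObs X n ω, X n ω))) :=
        (lintegral_map hG (hY.prodMk (hX n))).symm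
    _ = _ := by
      rw [key, lintegral_withDensity_eq_lintegral_mul _ hpm hG,
        lintegral_prod _ (hpm.mul hG).aemeasurable,
        lintegral_map (hpm.mul hG).lintegral_prod_right' hY]
      rfl

end

/-! ### No loss of mass under a second-moment bound -/

/-- A sequence with constant mean which is bounded in `L²` and converges almost everywhere does not
lose mass in the limit. -/
lemma le_lintegral_liminf_of_lintegral_sq_le {P : Measure Ω} [IsProbabilityMeasure P]
    {g : ℕ → Ω → ℝ≥0∞} (hg : ∀ n, Measurable (g n)) {L K : ℝ≥0∞} (hL : ∀ n, ∫⁻ ω, g n ω ∂P = L)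
    (hK : ∀ n, ∫⁻ ω, g n ω ^ 2 ∂P ≤ K) (hKtop : K ≠ ∞)
    (hlim : ∀ᵐ ω ∂P, ∃ l, Tendsto (fun n ↦ g n ω) atTop (𝓝 l)) :
    L ≤ ∫⁻ ω, liminf (fun n ↦ g n ω) atTop ∂P := by
  have hM : ∀ M : ℕ, L ≤ ∫⁻ ω, liminf (fun n ↦ g n ω) atTop ∂P + K / ((M + 1 : ℕ) : ℝ≥0∞) := by
    intro M
    set m : ℝ≥0∞ := ((M + 1 : ℕ) : ℝ≥0∞) with hm
    have hm0 : m ≠ 0 := by simp [hm]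
    have hmtop : m ≠ ∞ := ENNReal.natCast_ne_top _
    -- Truncation at level `m` costs at most `K / m` in mean, uniformly in `n`; the truncated
    -- sequence is handled by dominated convergence, and finally `m → ∞`.
    have hpt : ∀ a : ℝ≥0∞, a ≤ min a m + a ^ 2 / m := by
      intro a
      rcases le_total a m with h | h
      · simp [min_eq_left h]
      · refine le_add_left ?_
        rw [ENNReal.le_div_iff_mul_le (Or.inl hm0) (Or.inl hmtop), sq]
        gcongr
    have hle : ∀ n, L ≤ ∫⁻ ω, min (g n ω) m ∂P + K / m := by
      intro n
      calc L = ∫⁻ ω, g n ω ∂P := (hL n).symm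
        _ ≤ ∫⁻ ω, (min (g n ω) m + g n ω ^ 2 / m) ∂P := lintegral_mono fun ω ↦ hpt _
        _ = ∫⁻ ω, min (g n ω) m ∂P + (∫⁻ ω, g n ω ^ 2 ∂P) / m := by
          rw [lintegral_add_left ((hg n).min measurable_const)]
          simp_rw [div_eq_mul_inv]
          rw [lintegral_mul_const _ ((hg n).pow_const 2)]
        _ ≤ _ := by gcongr; exact hK n
    have htend : Tendsto (fun n ↦ ∫⁻ ω, min (g n ω) m ∂P) atTop
        (𝓝 (∫⁻ ω, min (liminf (fun n ↦ g n ω) atTop) m ∂P)) := by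
      refine tendsto_lintegral_of_dominated_convergence (fun _ ↦ m)
        (fun n ↦ (hg n).min measurable_const) (fun n ↦ ae_of_all _ fun ω ↦ min_le_right _ _)
        (by simpa using hmtop) ?_
      filter_upwards [hlim] with ω ⟨l, hl⟩
      rw [hl.liminf_eq]
      exact hl.min tendsto_const_nhds
    calc L ≤ ∫⁻ ω, min (liminf (fun n ↦ g n ω) atTop) m ∂P + K / m :=
          ge_of_tendsto' (htend.add_const _) hle
      _ ≤ _ := by gcongr; exact min_le_left _ _
  have ht : Tendsto (fun M : ℕ ↦ ∫⁻ ω, liminf (fun n ↦ g n ω) atTop ∂P + K / ((M + 1 : ℕ) : ℝ≥0∞)) atTop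
      (𝓝 (∫⁻ ω, liminf (fun n ↦ g n ω) atTop ∂P + 0)) := by
    refine Tendsto.const_add _ ?_
    have h0 : Tendsto (fun M : ℕ ↦ K / (M : ℝ≥0∞)) atTop (𝓝 0) := by
      have := ENNReal.Tendsto.const_mul (a := K) ENNReal.tendsto_inv_nat_nhds_zero (Or.inr hKtop)
      simpa [div_eq_mul_inv] using this
    exact h0.comp (tendsto_add_atTop_nat 1)
  simpa using ge_of_tendsto' ht hM

/-! ### The martingale of predictive densities at a fixed point -/

section

variable {P : Measure Ω} [IsProbabilityMeasure P] {X : ℕ → Ω → ℝ} (hX : ∀ n, Measurable (X n))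
  {f₀ : ℝ → ℝ} (hf₀ : IsDensity f₀) {c : ℕ → ℝ → ℝ → ℝ} (hc : ∀ n, IsCopulaDensity (c n))
  {r : ℕ → ℝ} (hr : ∀ n, r n ∈ Ioc (0 : ℝ) 1)
  (hpred : HasPredictives P X (copulaPredictive f₀ c r X))

include hX hf₀ hc

lemma measurable_predDensity_firstObs (n : ℕ) :
    Measurable fun q : Ω × ℝ ↦ predDensity f₀ c r n (firstObs X n q.1) q.2 :=
  (measurable_uncurry_predDensity hf₀ hc r n).comp
    (((measurable_firstObs hX n).comp measurable_fst).prodMk measurable_snd)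

lemma measurable_lintegral_copulaStep (n : ℕ) {φ : ℝ → ℝ≥0∞} (hφ : Measurable φ) :
    Measurable fun q : Ω × ℝ ↦
      ∫⁻ z, ENNReal.ofReal (predDensity f₀ c r n (firstObs X n q.1) z) *
        φ (copulaStep (predDensity f₀ c r n (firstObs X n q.1)) (c n) (r n) z q.2) := by
  refine Measurable.lintegral_prod_right' (f := fun s : (Ω × ℝ) × ℝ ↦
    ENNReal.ofReal (predDensity f₀ c r n (firstObs X n s.1.1) s.2) *
        φ (copulaStep (predDensity f₀ c r n (firstObs X n s.1.1)) (c n) (r n) s.2 s.1.2)) ?_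
  refine ((measurable_predDensity_firstObs hX hf₀ hc n).comp
    (g := fun q : Ω × ℝ ↦ predDensity f₀ c r n (firstObs X n q.1) q.2)
    (f := fun s : (Ω × ℝ) × ℝ ↦ (s.1.1, s.2)) (by fun_prop)).ennreal_ofReal.mul (hφ.comp ?_)
  exact (measurable_copulaStep (g := fun ω ↦ predDensity f₀ c r n (firstObs X n ω))
    (measurable_predDensity_firstObs hX hf₀ hc n) (hc n) (r n)).comp
    (f := fun s : (Ω × ℝ) × ℝ ↦ ((s.1.1, s.2), s.1.2)) (by fun_prop)

include hr hpred

lemma ae_isDensity_predDensity (n : ℕ) :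
    ∀ᵐ ω ∂P, IsDensity (predDensity f₀ c r n (firstObs X n ω)) :=
  ae_isDensity hX (measurable_uncurry_predDensity hf₀ hc r) (predDensity_nonneg hf₀ hc hr) hpred n

/-- One-step conditioning on `X(n)`. Indicator weights `W` with `φ` the embedding give the
martingale property; `W = 1` with `φ` the square gives the second-moment recursion. -/
lemma lintegral_comp_predDensity_succ (n : ℕ) {W : (Fin n → ℝ) → ℝ≥0∞} (hW : Measurable W)
    {φ : ℝ → ℝ≥0∞} (hφ : Measurable φ) (x : ℝ) :
    ∫⁻ ω, W (firstObs X n ω) * φ (predDensity f₀ c r (n + 1) (firstObs X (n + 1) ω) x) ∂P =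
      ∫⁻ ω, W (firstObs X n ω) * (∫⁻ z, ENNReal.ofReal (predDensity f₀ c r n (firstObs X n ω) z) *
        φ (copulaStep (predDensity f₀ c r n (firstObs X n ω)) (c n) (r n) z x)) ∂P := by
  have hS : Measurable fun q : (Fin n → ℝ) × ℝ ↦
      φ (copulaStep (predDensity f₀ c r n q.1) (c n) (r n) q.2 x) :=
    hφ.comp ((measurable_copulaStep (measurable_uncurry_predDensity hf₀ hc r n) (hc n) (r n)).comp
      (measurable_id.prodMk measurable_const))
  have h := lintegral_firstObs_obs hX (measurable_uncurry_predDensity hf₀ hc r)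
    (predDensity_nonneg hf₀ hc hr) hpred n (G := fun q ↦ W q.1 *
      φ (copulaStep (predDensity f₀ c r n q.1) (c n) (r n) q.2 x))
    ((hW.comp measurable_fst).mul hS)
  refine h.trans (lintegral_congr fun ω ↦ ?_)
  rw [← lintegral_const_mul]
  · exact lintegral_congr fun z ↦ by ring
  · exact ((measurable_uncurry_predDensity hf₀ hc r n).comp
      measurable_prodMk_left).ennreal_ofReal.mul (hS.comp measurable_prodMk_left)

lemma ae_setLIntegral_predDensity_succ (n : ℕ) : ∀ᵐ x, ∀ B : Set (Fin n → ℝ), MeasurableSet B →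
    ∫⁻ ω in firstObs X n ⁻¹' B,
      ENNReal.ofReal (predDensity f₀ c r (n + 1) (firstObs X (n + 1) ω) x) ∂P =
    ∫⁻ ω in firstObs X n ⁻¹' B, ENNReal.ofReal (predDensity f₀ c r n (firstObs X n ω) x) ∂P := by
  have h : ∀ᵐ ω ∂P, ∀ᵐ x, ∫⁻ z, ENNReal.ofReal (predDensity f₀ c r n (firstObs X n ω) z) *
        ENNReal.ofReal (copulaStep (predDensity f₀ c r n (firstObs X n ω)) (c n) (r n) z x) =
      ENNReal.ofReal (predDensity f₀ c r n (firstObs X n ω) x) := by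
    filter_upwards [ae_isDensity_predDensity hX hf₀ hc hr hpred n] with ω hω
    exact hω.ae_lintegral_copulaStep (hc n) (hr n)
  have hset := measurableSet_eq_fun
    (measurable_lintegral_copulaStep (r := r) hX hf₀ hc n ENNReal.measurable_ofReal)
    (measurable_predDensity_firstObs (r := r) hX hf₀ hc n).ennreal_ofReal
  -- The null set of `x` so far depends on `ω`; Fubini exchanges the quantifiers, and the resulting
  -- null set of `x` serves every `B`.
  replace h := (Measure.ae_ae_comm (by exact hset)).1 h
  filter_upwards [h] with x hx B hB
  have hB' := measurable_firstObs hX n hB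
  have h1 := lintegral_comp_predDensity_succ hX hf₀ hc hr hpred n
    (W := B.indicator 1) (measurable_const.indicator hB) ENNReal.measurable_ofReal x
  have h2 : ∫⁻ ω, B.indicator 1 (firstObs X n ω) *
        ENNReal.ofReal (predDensity f₀ c r n (firstObs X n ω) x) ∂P = _ :=
    (lintegral_congr_ae (hx.mono fun ω hω ↦ by rw [hω])).symm.trans h1.symm
  have h3 : ∀ g : Ω → ℝ≥0∞, ∫⁻ ω, B.indicator 1 (firstObs X n ω) * g ω ∂P =
      ∫⁻ ω in firstObs X n ⁻¹' B, g ω ∂P := by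
    intro g
    rw [← lintegral_indicator hB']
    refine lintegral_congr fun ω ↦ ?_
    by_cases hω : firstObs X n ω ∈ B <;> simp [indicator, hω]
  rw [← h3, ← h3]
  exact h2.symm

lemma ae_lintegral_predDensity_succ_sq_le {b : ℝ}
    (hb : ∀ n, ∀ u ∈ Icc (0 : ℝ) 1, ∀ v ∈ Icc (0 : ℝ) 1, c n u v ≤ b) (n : ℕ) :
    ∀ᵐ x, ∫⁻ ω, ENNReal.ofReal (predDensity f₀ c r (n + 1) (firstObs X (n + 1) ω) x ^ 2) ∂P ≤
      ENNReal.ofReal (1 + b * r n ^ 2) *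
        ∫⁻ ω, ENNReal.ofReal (predDensity f₀ c r n (firstObs X n ω) x ^ 2) ∂P := by
  have hφ : Measurable fun t : ℝ ↦ ENNReal.ofReal (t ^ 2) := by fun_prop
  have hm : Measurable fun q : Ω × ℝ ↦
      ENNReal.ofReal (predDensity f₀ c r n (firstObs X n q.1) q.2 ^ 2) :=
    ((measurable_predDensity_firstObs hX hf₀ hc n).pow_const 2).ennreal_ofReal
  have h : ∀ᵐ ω ∂P, ∀ᵐ x, ∫⁻ z, ENNReal.ofReal (predDensity f₀ c r n (firstObs X n ω) z) *
      ENNReal.ofReal (copulaStep (predDensity f₀ c r n (firstObs X n ω)) (c n) (r n) z x ^ 2) ≤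
      ENNReal.ofReal (1 + b * r n ^ 2) *
        ENNReal.ofReal (predDensity f₀ c r n (firstObs X n ω) x ^ 2) := by
    filter_upwards [ae_isDensity_predDensity hX hf₀ hc hr hpred n] with ω hω
    exact hω.ae_lintegral_copulaStep_sq_le (hc n) (hr n) (hb n)
  have hset := measurableSet_le (measurable_lintegral_copulaStep (r := r) hX hf₀ hc n hφ)
    (hm.const_mul (ENNReal.ofReal (1 + b * r n ^ 2)))
  replace h := (Measure.ae_ae_comm (by exact hset)).1 h
  filter_upwards [h] with x hx
  have h1 := lintegral_comp_predDensity_succ hX hf₀ hc hr hpred n (W := 1) measurable_const hφ x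
  simp only [Pi.one_apply, one_mul] at h1
  rw [h1]
  exact (lintegral_mono_ae hx).trans_eq
    (lintegral_const_mul _ (hm.comp measurable_prodMk_right))

lemma ae_lintegral_predDensity_sq_le (hr_sq : Summable fun n ↦ r n ^ 2) {b : ℝ}
    (hb : ∀ n, ∀ u ∈ Icc (0 : ℝ) 1, ∀ v ∈ Icc (0 : ℝ) 1, c n u v ≤ b) :
    ∀ᵐ x, ∀ n, ∫⁻ ω, ENNReal.ofReal (predDensity f₀ c r n (firstObs X n ω) x) ^ 2 ∂P ≤
      ENNReal.ofReal (Real.exp (b * ∑' k, r k ^ 2) * f₀ x ^ 2) := by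
  have hb0 : 0 ≤ b := ((hc 0).nonneg 0 0).trans (hb 0 0 (by simp) 0 (by simp))
  have h := ae_all_iff.2 (ae_lintegral_predDensity_succ_sq_le hX hf₀ hc hr hpred hb)
  filter_upwards [h] with x hx n
  simp_rw [← ENNReal.ofReal_pow (predDensity_nonneg hf₀ hc hr _ _ _)]
  have hn : ∫⁻ ω, ENNReal.ofReal (predDensity f₀ c r n (firstObs X n ω) x ^ 2) ∂P ≤
      ENNReal.ofReal (Real.exp (b * ∑ k ∈ Finset.range n, r k ^ 2) * f₀ x ^ 2) := by
    induction n with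
    | zero => simp [predDensity]
    | succ n ih =>
      refine (hx n).trans ((mul_le_mul_right ih _).trans ?_)
      rw [← ENNReal.ofReal_mul (by positivity), Finset.sum_range_succ, mul_add, Real.exp_add]
      apply ENNReal.ofReal_le_ofReal
      -- The product of the factors `1 + b * r k ^ 2` is bounded by the exponential of a sum.
      have := Real.add_one_le_exp (b * r n ^ 2)
      calc _ ≤ Real.exp (b * r n ^ 2) * (Real.exp (b * ∑ k ∈ Finset.range n, r k ^ 2) * f₀ x ^ 2) := by
            gcongr
            linarith
        _ = _ := by ring
  refine hn.trans (ENNReal.ofReal_le_ofReal ?_)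
  gcongr
  exact hr_sq.sum_le_tsum _ fun k _ ↦ by positivity

lemma ae_martingale_predDensity :
    ∀ᵐ x, (∀ n, ∫⁻ ω, ENNReal.ofReal (predDensity f₀ c r n (firstObs X n ω) x) ∂P =
        ENNReal.ofReal (f₀ x)) ∧
      Martingale (fun n ω ↦ predDensity f₀ c r n (firstObs X n ω) x) (obsFiltration hX) P := by
  filter_upwards [ae_all_iff.2 (ae_setLIntegral_predDensity_succ hX hf₀ hc hr hpred)] with x hx
  have hmean : ∀ n, ∫⁻ ω, ENNReal.ofReal (predDensity f₀ c r n (firstObs X n ω) x) ∂P =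
      ENNReal.ofReal (f₀ x) := by
    intro n
    induction n with
    | zero => simp [predDensity]
    | succ n ih =>
      rw [← ih]
      simpa using hx n univ MeasurableSet.univ
  have hmeas : ∀ n, Measurable fun ω ↦ predDensity f₀ c r n (firstObs X n ω) x := fun n ↦
    (measurable_predDensity_firstObs hX hf₀ hc n).comp measurable_prodMk_right
  have hnn : ∀ n ω, 0 ≤ predDensity f₀ c r n (firstObs X n ω) x :=
    fun n ω ↦ predDensity_nonneg hf₀ hc hr _ _ _
  refine ⟨hmean, martingale_of_setIntegral_eq_succ (fun n ↦ ?_) (fun n ↦ ?_) fun n s hs ↦ ?_⟩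
  · refine Measurable.stronglyMeasurable ?_
    exact ((measurable_uncurry_predDensity hf₀ hc r n).comp measurable_prodMk_right).comp
      (comap_measurable (firstObs X n))
  · refine ⟨(hmeas n).aestronglyMeasurable, ?_⟩
    rw [hasFiniteIntegral_iff_ofReal (ae_of_all _ (hnn n)), hmean n]
    exact ENNReal.ofReal_lt_top
  · obtain ⟨B, hB, rfl⟩ := hs
    rw [integral_eq_lintegral_of_nonneg_ae (ae_of_all _ (hnn n)) (hmeas n).aestronglyMeasurable,
      integral_eq_lintegral_of_nonneg_ae (ae_of_all _ (hnn (n + 1)))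
        (hmeas (n + 1)).aestronglyMeasurable, hx n B hB]

/-- Nonnegativity and constant mean bound the martingale in `L¹` by `f₀ x`, so Doob's convergence
theorem applies. -/
lemma ae_ae_exists_tendsto_predDensity :
    ∀ᵐ x, ∀ᵐ ω ∂P, ∃ l, Tendsto (fun n ↦ predDensity f₀ c r n (firstObs X n ω) x) atTop (𝓝 l) := by
  filter_upwards [ae_martingale_predDensity hX hf₀ hc hr hpred] with x ⟨hmean, hmart⟩
  refine hmart.submartingale.exists_ae_tendsto_of_bdd (R := (f₀ x).toNNReal) fun n ↦ ?_
  rw [eLpNorm_one_eq_lintegral_enorm]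
  refine le_of_eq ((lintegral_congr fun ω ↦ ?_).trans (hmean n))
  exact Real.enorm_of_nonneg (predDensity_nonneg hf₀ hc hr _ _ _)

lemma ae_le_lintegral_liminf_predDensity (hr_sq : Summable fun n ↦ r n ^ 2) {b : ℝ}
    (hb : ∀ n, ∀ u ∈ Icc (0 : ℝ) 1, ∀ v ∈ Icc (0 : ℝ) 1, c n u v ≤ b) :
    ∀ᵐ x, ENNReal.ofReal (f₀ x) ≤ ∫⁻ ω, liminf
      (fun n ↦ ENNReal.ofReal (predDensity f₀ c r n (firstObs X n ω) x)) atTop ∂P := by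
  filter_upwards [ae_martingale_predDensity hX hf₀ hc hr hpred,
    ae_lintegral_predDensity_sq_le hX hf₀ hc hr hpred hr_sq hb,
    ae_ae_exists_tendsto_predDensity hX hf₀ hc hr hpred] with x ⟨hmean, _⟩ hsq hlim
  refine le_lintegral_liminf_of_lintegral_sq_le (fun n ↦ ?_) hmean hsq ENNReal.ofReal_ne_top
    (hlim.mono fun ω ⟨l, hl⟩ ↦ ⟨_, ENNReal.tendsto_ofReal hl⟩)
  exact ((measurable_predDensity_firstObs hX hf₀ hc n).comp measurable_prodMk_right).ennreal_ofReal

end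

/-! ### From a.e. convergence of densities to total variation and weak convergence -/

lemma IsDensity.integral_eq_one {f : ℝ → ℝ} (hf : IsDensity f) : ∫ x, f x = 1 := by
  rw [integral_eq_lintegral_of_nonneg_ae (ae_of_all _ hf.nonneg)
    hf.measurable.aestronglyMeasurable, hf.lintegral_eq_one, ENNReal.toReal_one]

lemma IsDensity.measureReal_densityMeasure {f : ℝ → ℝ} (hf : IsDensity f) {A : Set ℝ}
    (hA : MeasurableSet A) : (densityMeasure f).real A = ∫ x in A, f x := by
  rw [measureReal_def, densityMeasure, withDensity_apply _ hA,
    integral_eq_lintegral_of_nonneg_ae (ae_of_all _ hf.nonneg) hf.measurable.aestronglyMeasurable]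

lemma IsDensity.integral_densityMeasure {f : ℝ → ℝ} (hf : IsDensity f) (g : ℝ → ℝ) :
    ∫ x, g x ∂(densityMeasure f) = ∫ x, f x * g x := by
  rw [densityMeasure, integral_withDensity_eq_integral_toReal_smul hf.measurable.ennreal_ofReal
    (ae_of_all _ fun _ ↦ ENNReal.ofReal_lt_top)]
  simp [ENNReal.toReal_ofReal (hf.nonneg _)]

/-- **Scheffé's lemma** for densities on the real line. -/
lemma tendsto_integral_abs_sub_of_ae_tendsto {p : ℕ → ℝ → ℝ} {f : ℝ → ℝ}
    (hp : ∀ n, IsDensity (p n)) (hf : IsDensity f)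
    (h : ∀ᵐ x, Tendsto (fun n ↦ p n x) atTop (𝓝 (f x))) :
    Tendsto (fun n ↦ ∫ x, |p n x - f x|) atTop (𝓝 0) := by
  have hint : ∀ n, Integrable fun x ↦ max (f x - p n x) 0 := fun n ↦
    (hf.integrable.sub (hp n).integrable).pos_part
  have hpos : Tendsto (fun n ↦ ∫ x, max (f x - p n x) 0) atTop (𝓝 (∫ _ : ℝ, (0 : ℝ))) := by
    refine tendsto_integral_of_dominated_convergence f (fun n ↦ (hint n).aestronglyMeasurable)
      hf.integrable (fun n ↦ ae_of_all _ fun x ↦ ?_) ?_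
    · rw [Real.norm_of_nonneg (le_max_right _ _)]
      exact max_le (by linarith [(hp n).nonneg x]) (hf.nonneg x)
    · filter_upwards [h] with x hx
      have h1 : Tendsto (fun n ↦ max (f x - p n x) 0) atTop (𝓝 (max (f x - f x) 0)) :=
        (tendsto_const_nhds.sub hx).max tendsto_const_nhds
      simpa using h1
  -- Equal total masses make the integral of `p n - f` vanish, leaving only the positive part of `f
  -- - p n`, which is dominated by `f`.
  have heq : ∀ n, ∫ x, |p n x - f x| = 2 * ∫ x, max (f x - p n x) 0 := by
    intro n
    have h1 : ∀ x, |p n x - f x| = (p n x - f x) + 2 * max (f x - p n x) 0 := by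
      intro x
      rcases le_total (p n x) (f x) with hle | hle
      · rw [abs_of_nonpos (by linarith), max_eq_left (by linarith)]; ring
      · rw [abs_of_nonneg (by linarith), max_eq_right (by linarith)]; ring
    simp_rw [h1]
    rw [integral_add (by exact (hp n).integrable.sub hf.integrable) ((hint n).const_mul 2),
      integral_sub (hp n).integrable hf.integrable, (hp n).integral_eq_one, hf.integral_eq_one,
      integral_const_mul]
    ring
  simp_rw [heq]
  simpa using hpos.const_mul 2

lemma IsDensity.tvDist_le {p f : ℝ → ℝ} (hp : IsDensity p) (hf : IsDensity f) :
    tvDist (densityMeasure p) (densityMeasure f) ≤ ∫ x, |p x - f x| := by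
  have : Nonempty {A : Set ℝ // MeasurableSet A} := ⟨⟨univ, MeasurableSet.univ⟩⟩
  refine ciSup_le fun ⟨A, hA⟩ ↦ ?_
  rw [hp.measureReal_densityMeasure hA, hf.measureReal_densityMeasure hA,
    ← integral_sub hp.integrable.integrableOn hf.integrable.integrableOn]
  exact abs_integral_le_integral_abs.trans (setIntegral_le_integral
    (hp.integrable.sub hf.integrable).abs (ae_of_all _ fun _ ↦ abs_nonneg _))

lemma tendsto_tvDist_of_ae_tendsto {p : ℕ → ℝ → ℝ} {f : ℝ → ℝ}
    (hp : ∀ n, IsDensity (p n)) (hf : IsDensity f)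
    (h : ∀ᵐ x, Tendsto (fun n ↦ p n x) atTop (𝓝 (f x))) :
    Tendsto (fun n ↦ tvDist (densityMeasure (p n)) (densityMeasure f)) atTop (𝓝 0) :=
  squeeze_zero (fun _ ↦ Real.iSup_nonneg fun _ ↦ abs_nonneg _) (fun n ↦ (hp n).tvDist_le hf)
    (tendsto_integral_abs_sub_of_ae_tendsto hp hf h)

lemma weaklyTendsto_of_ae_tendsto {p : ℕ → ℝ → ℝ} {f : ℝ → ℝ}
    (hp : ∀ n, IsDensity (p n)) (hf : IsDensity f)
    (h : ∀ᵐ x, Tendsto (fun n ↦ p n x) atTop (𝓝 (f x))) :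
    WeaklyTendsto (fun n ↦ densityMeasure (p n)) (densityMeasure f) := by
  intro g
  rw [tendsto_iff_dist_tendsto_zero]
  refine squeeze_zero (fun _ ↦ dist_nonneg) (fun n ↦ ?_)
    (g := fun n ↦ (∫ x, |p n x - f x|) * ‖g‖) (by
      simpa using (tendsto_integral_abs_sub_of_ae_tendsto hp hf h).mul_const ‖g‖)
  have hg : ∀ {q : ℝ → ℝ}, IsDensity q → Integrable fun x ↦ q x * g x := fun hq ↦
    hq.integrable.mul_bdd (c := ‖g‖) g.continuous.aestronglyMeasurable
      (ae_of_all _ g.norm_coe_le_norm)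
  rw [(hp n).integral_densityMeasure, hf.integral_densityMeasure, Real.dist_eq,
    ← integral_sub (hg (hp n)) (hg hf), ← integral_mul_const]
  refine abs_integral_le_integral_abs.trans (integral_mono ((hg (hp n)).sub (hg hf)).abs
    (((hp n).integrable.sub hf.integrable).abs.mul_const _) fun x ↦ ?_)
  simp only
  rw [← sub_mul, abs_mul]
  exact mul_le_mul_of_nonneg_left (g.norm_coe_le_norm x) (abs_nonneg _)

/-! ### The limiting random density -/

/-- The Markov kernel with a given jointly measurable family of densities. -/
lemma exists_kernel_eq_densityMeasure {f : Ω → ℝ → ℝ}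
    (hf_meas : Measurable (Function.uncurry f)) (hf : ∀ ω, IsDensity (f ω)) :
    ∃ β : Kernel Ω ℝ, IsMarkovKernel β ∧ ∀ ω, β ω = densityMeasure (f ω) := by
  have h : ∀ ω, (Kernel.const Ω (volume : Measure ℝ)).withDensity
      (fun ω x ↦ ENNReal.ofReal (f ω x)) ω = densityMeasure (f ω) := by
    intro ω
    rw [Kernel.withDensity_apply _ (by exact hf_meas.ennreal_ofReal)]
    rfl
  refine ⟨_, ⟨fun ω ↦ ?_⟩, h⟩
  rw [h]
  exact (hf ω).isProbabilityMeasure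

/-- The predictive densities converge almost everywhere to a random probability density. -/
lemma exists_ae_tendsto_predDensity {P : Measure Ω} [IsProbabilityMeasure P] {X : ℕ → Ω → ℝ} (hX : ∀ n, Measurable (X n))
    {f₀ : ℝ → ℝ} (hf₀ : IsDensity f₀) {c : ℕ → ℝ → ℝ → ℝ} (hc : ∀ n, IsCopulaDensity (c n))
    {r : ℕ → ℝ} (hr : ∀ n, r n ∈ Ioc (0 : ℝ) 1)
    (hpred : HasPredictives P X (copulaPredictive f₀ c r X))
    (hr_sq : Summable fun n ↦ r n ^ 2) {b : ℝ}
    (hb : ∀ n, ∀ u ∈ Icc (0 : ℝ) 1, ∀ v ∈ Icc (0 : ℝ) 1, c n u v ≤ b) :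
    ∃ f : Ω → ℝ → ℝ, Measurable (Function.uncurry f) ∧ (∀ ω, IsDensity (f ω)) ∧
      ∀ᵐ ω ∂P, ∀ᵐ x,
        Tendsto (fun n ↦ predDensity f₀ c r n (firstObs X n ω) x) atTop (𝓝 (f ω x)) := by
  classical
  have hm := measurable_predDensity_firstObs (r := r) hX hf₀ hc
  set L : Ω × ℝ → ℝ≥0∞ := fun q ↦
    liminf (fun n ↦ ENNReal.ofReal (predDensity f₀ c r n (firstObs X n q.1) q.2)) atTop with hL
  have hLm : Measurable L := Measurable.liminf fun n ↦ (hm n).ennreal_ofReal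
  have hdens : ∀ᵐ ω ∂P, ∀ n, IsDensity (predDensity f₀ c r n (firstObs X n ω)) :=
    ae_all_iff.2 (ae_isDensity_predDensity hX hf₀ hc hr hpred)
  have hle : (fun ω ↦ ∫⁻ x, L (ω, x)) ≤ᵐ[P] fun _ ↦ 1 := by
    filter_upwards [hdens] with ω hω
    refine (lintegral_liminf_le fun n ↦ (hω n).measurable.ennreal_ofReal).trans ?_
    simp [(hω _).lintegral_eq_one]
  have hmean : 1 ≤ ∫⁻ ω, (∫⁻ x, L (ω, x)) ∂P := by
    rw [lintegral_lintegral_swap (f := fun ω x ↦ L (ω, x)) hLm.aemeasurable,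
      ← hf₀.lintegral_eq_one]
    exact lintegral_mono_ae (ae_le_lintegral_liminf_predDensity hX hf₀ hc hr hpred hr_sq hb)
  -- The mass is at most `1` a.s. by Fatou and at least `1` in expectation, which forces equality
  -- a.s.
  have hone : (fun ω ↦ ∫⁻ x, L (ω, x)) =ᵐ[P] fun _ ↦ 1 := by
    refine ae_eq_of_ae_le_of_lintegral_le hle ?_ aemeasurable_const (by simpa using hmean)
    exact ((lintegral_mono_ae hle).trans_lt (by simp)).ne
  have hlim : ∀ᵐ ω ∂P, ∀ᵐ x, ∃ l,
      Tendsto (fun n ↦ predDensity f₀ c r n (firstObs X n ω) x) atTop (𝓝 l) :=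
    (Measure.ae_ae_comm (by exact measurableSet_exists_tendsto hm)).2
      (ae_ae_exists_tendsto_predDensity hX hf₀ hc hr hpred)
  set g : Ω × ℝ → ℝ := fun q ↦ (L q).toReal with hg
  have hgm : Measurable g := hLm.ennreal_toReal
  set S : Set Ω := {ω | ∫⁻ x, ENNReal.ofReal (g (ω, x)) = 1} with hS
  have hSm : MeasurableSet S :=
    measurableSet_eq_fun hgm.ennreal_ofReal.lintegral_prod_right' measurable_const
  -- Off the measurable event `S`, of full probability, `f₀` is a default value making every section
  -- a density.
  refine ⟨fun ω x ↦ if ω ∈ S then g (ω, x) else f₀ x, ?_, fun ω ↦ ?_, ?_⟩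
  · exact Measurable.ite (measurable_fst hSm) hgm (hf₀.measurable.comp measurable_snd)
  · by_cases hω : ω ∈ S
    · simp only [if_pos hω]
      exact ⟨hgm.comp measurable_prodMk_left, fun x ↦ ENNReal.toReal_nonneg, hω⟩
    · simp only [if_neg hω]
      exact hf₀
  · filter_upwards [hone, hlim] with ω h1 h2
    have h3 : ∀ᵐ x, Tendsto (fun n ↦ predDensity f₀ c r n (firstObs X n ω) x) atTop
        (𝓝 (g (ω, x))) ∧ ENNReal.ofReal (g (ω, x)) = L (ω, x) := by
      filter_upwards [h2] with x ⟨l, hl⟩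
      have hl0 : 0 ≤ l := ge_of_tendsto' hl fun n ↦ predDensity_nonneg hf₀ hc hr _ _ _
      have hLl : L (ω, x) = ENNReal.ofReal l := (ENNReal.tendsto_ofReal hl).liminf_eq
      simp only [hg, hLl, ENNReal.toReal_ofReal hl0]
      exact ⟨hl, trivial⟩
    have hω : ω ∈ S := (lintegral_congr_ae (h3.mono fun x hx ↦ hx.2)).trans h1
    filter_upwards [h3] with x hx
    simpa only [if_pos hω] using hx.1

end CopulaPredictive

theorem theorem4 {Ω : Type*} [MeasurableSpace Ω] (P : Measure Ω) [IsProbabilityMeasure P]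
    (X : ℕ → Ω → ℝ) (hX : ∀ n, Measurable (X n))
    (f₀ : ℝ → ℝ) (hf₀ : CopulaPredictive.IsDensity f₀) (hf₀_pos : ∀ x, 0 < f₀ x)
    (c : ℕ → ℝ → ℝ → ℝ) (hc : ∀ n, CopulaPredictive.IsCopulaDensity (c n))
    (hc_pos : ∀ n, ∀ u ∈ Ioo (0 : ℝ) 1, ∀ v ∈ Ioo (0 : ℝ) 1, 0 < c n u v)
    (r : ℕ → ℝ) (hr : ∀ n, r n ∈ Ioc (0 : ℝ) 1)
    (hpred : CopulaPredictive.HasPredictives P X (CopulaPredictive.copulaPredictive f₀ c r X))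
    (hf₀_sq : Integrable (fun x => f₀ x ^ 2))
    (hr_sq : Summable (fun n => r n ^ 2))
    (b : ℝ) (hb : ∀ n, ∀ u ∈ Icc (0 : ℝ) 1, ∀ v ∈ Icc (0 : ℝ) 1, c n u v ≤ b) :
    ∃ β : Kernel Ω ℝ, IsMarkovKernel β ∧
      (∀ᵐ ω ∂P, CopulaPredictive.WeaklyTendsto
        (fun n => CopulaPredictive.copulaPredictive f₀ c r X n ω) (β ω)) ∧
      (∃ f : Ω → ℝ → ℝ, Measurable (Function.uncurry f) ∧
        (∀ ω, CopulaPredictive.IsDensity (f ω)) ∧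
        ∀ᵐ ω ∂P, β ω = CopulaPredictive.densityMeasure (f ω)) ∧
      (∀ᵐ ω ∂P, Tendsto
        (fun n => CopulaPredictive.tvDist
          (CopulaPredictive.copulaPredictive f₀ c r X n ω) (β ω)) atTop (𝓝 0)) := by
  obtain ⟨f, hf_meas, hf, hlim⟩ :=
    CopulaPredictive.exists_ae_tendsto_predDensity hX hf₀ hc hr hpred hr_sq hb
  obtain ⟨β, hβ, hβf⟩ := CopulaPredictive.exists_kernel_eq_densityMeasure hf_meas hf
  have hdens := ae_all_iff.2
    (CopulaPredictive.ae_isDensity_predDensity hX hf₀ hc hr hpred)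
  refine ⟨β, hβ, ?_, ⟨f, hf_meas, hf, ae_of_all _ hβf⟩, ?_⟩
  · filter_upwards [hlim, hdens] with ω hω hd
    rw [hβf ω]
    exact CopulaPredictive.weaklyTendsto_of_ae_tendsto hd (hf ω) hω
  · filter_upwards [hlim, hdens] with ω hω hd
    rw [hβf ω]
    exact CopulaPredictive.tendsto_tvDist_of_ae_tendsto hd (hf ω) hω
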